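/- Let $\mathbb{K}$ be an algebraically closed field and let $Q\subset\mathbb{K}[[X_1,\ldots,X_n]]$ be an algebroid curve, i.e. a proper radical ideal whose distinct minimal primes $P_1,\ldots,P_r$ are such that each ring $\mathcal{O}_i=\mathbb{K}[[X_1,\ldots,X_n]]/P_i$ has Krull dimension one. Put $I=\{1,\ldots,r\}$, let $\mathcal{O}=\mathbb{K}[[X_1,\ldots,X_n]]/Q$ be the local ring of the curve and $\mathcal{M}$ its maximal ideal. For $g\in\mathcal{O}$ and $i\in I$ let $v_i(g)\in\mathbb{N}\cup\{\infty\}$ be the value of the image of $g$ in $\mathcal{O}_i$ under the normalized discrete valuation of the integral closure $\overline{\mathcal{O}}_i$ of $\mathcal{O}_i$ in its field of fractions (so $v_i(g)=\infty$ if the image of $g$ in $\mathcal{O}_i$ is $0$), and let $I_g=\{i\in I:\ v_i(g)\neq\infty\}$. Let $G=\{g_1,\ldots,g_m\}$ be a nonempty finite subset of $\mathcal{M}\setminus\{0\}$. A $G$-product is an element $G^\alpha=\prod_{j=1}^m g_j^{\alpha_j}$ with $\alpha\in\mathbb{N}^m$. For nonzero $g\in\mathcal{O}$ and $k\in I_g$,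 an element $h\in\mathcal{O}$ is a $k$-reduction of $g$ modulo $G$ if $h=g-cG^\alpha$ for some $c\in\mathbb{K}$ and some $G$-product $G^\alpha$, with $v_i(h)\geq v_i(g)$ for all $i\in I$ and $v_k(h)>v_k(g)$; it is a reduction of $g$ modulo $G$ if it is a $k$-reduction for some $k\in I_g$. A nonempty finite subset of $\mathcal{M}\setminus\{0\}$ is a Standard Basis for $\mathcal{O}$ if every nonzero $g\in\mathcal{O}$ has a reduction modulo it. The following statements are equivalent: 1. every nonzero $g\in\mathcal{O}$ has a $k$-reduction modulo $G$ for all $k\in I_g$; 2. every nonzero $g\in\mathcal{O}$ has a reduction modulo $G$; 3. $G$ is a Standard Basis for $\mathcal{O}$; 4. for every nonzero $g\in\mathcal{O}$ there are some $k\in I_g$ and a $G$-product $G^\alpha$ such that $v_i(g)\leq v_i(G^\alpha)$ for all $i\in I$ and $v_k(g)=v_k(G^\alpha)$; 5. for every nonzero $g\in\mathcal{O}$ and all $k\in I_g$ there is a $G$-product $G^\alpha$ (depending on $k$) such that $v_i(g)\leq v_i(G^\alpha)$ for all $i\in I$ and $v_k(g)=v_k(G^\alpha)$. -/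

import Mathlib

/-- The order of an element `x` of a ring `A` along the powers of the Jacobson radical: the supremum
of all `n` with `x ∈ J ^ n`. In a discrete valuation ring the Jacobson radical is the maximal ideal,
and this is the normalized discrete valuation, with value `⊤` at `0`
(`normalizedVal_eq_addVal`). -/
noncomputable def normalizedVal {A : Type*} [CommRing A] (x : A) : ℕ∞ :=
  ⨆ (n : ℕ) (_ : x ∈ (Ideal.jacobson (⊥ : Ideal A)) ^ n), (n : ℕ∞)

theorem normalizedVal_eq_addVal {A : Type*} [CommRing A] [IsDomain A]
    [IsDiscreteValuationRing A] (x : A) :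
    normalizedVal x = IsDiscreteValuationRing.addVal A x := by
  obtain ⟨p, hp⟩ := IsDiscreteValuationRing.exists_irreducible A
  have key : ∀ n : ℕ, x ∈ (Ideal.jacobson (⊥ : Ideal A)) ^ n ↔
      (n : ℕ∞) ≤ IsDiscreteValuationRing.addVal A x := by
    intro n
    rw [IsLocalRing.jacobson_eq_maximalIdeal _ bot_ne_top, hp.maximalIdeal_eq,
      Ideal.span_singleton_pow, Ideal.mem_span_singleton, ← hp.addVal_pow n,
      IsDiscreteValuationRing.addVal_le_iff_dvd]
  unfold normalizedVal
  simp only [key]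
  apply le_antisymm
  · exact iSup₂_le fun n hn => hn
  · refine ENat.forall_natCast_le_iff_le.mp fun m hm => ?_
    exact le_iSup₂_of_le m hm le_rfl

/-- An algebroid curve in `n`-space over `K` with `r` branches: a proper radical ideal `Q` of
`K[[X₁, …, Xₙ]]` together with an enumeration `P₁, …, P_r`, without repetition, of its isolated
(minimal) primes, such that every `K[[X₁, …, Xₙ]] / Pᵢ` has Krull dimension one. -/
structure AlgebroidCurve (K : Type*) [Field K] (n r : ℕ) where
  /-- the ideal `Q` of the curve -/
  ideal : Ideal (MvPowerSeries (Fin n) K)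
  /-- the branches `P₁, …, P_r` -/
  branch : Fin r → Ideal (MvPowerSeries (Fin n) K)
  ne_top : ideal ≠ ⊤
  isRadical : ideal.IsRadical
  branch_injective : Function.Injective branch
  range_branch : Set.range branch = ideal.minimalPrimes
  ringKrullDim_branch : ∀ i, ringKrullDim (MvPowerSeries (Fin n) K ⧸ branch i) = 1

namespace AlgebroidCurve

variable {K : Type*} [Field K] {n r : ℕ} (C : AlgebroidCurve K n r)

theorem ideal_le_branch (i : Fin r) : C.ideal ≤ C.branch i := by
  have h : C.branch i ∈ C.ideal.minimalPrimes := C.range_branch ▸ Set.mem_range_self i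
  exact h.1.2

/-- The local ring `𝒪 = K[[X₁, …, Xₙ]] / Q` of the curve. -/
abbrev localRing : Type _ := MvPowerSeries (Fin n) K ⧸ C.ideal

instance isLocalRing_localRing : IsLocalRing C.localRing :=
  haveI : Nontrivial C.localRing := Ideal.Quotient.nontrivial_iff.mpr C.ne_top
  IsLocalRing.of_surjective' (Ideal.Quotient.mk C.ideal) Ideal.Quotient.mk_surjective

/-- The local ring `𝒪ᵢ = K[[X₁, …, Xₙ]] / Pᵢ` of the `i`-th branch. -/
abbrev branchRing (i : Fin r) : Type _ := MvPowerSeries (Fin n) K ⧸ C.branch i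

/-- The integral closure of `𝒪ᵢ` in its field of fractions. -/
abbrev branchClosure (i : Fin r) : Type _ :=
  integralClosure (C.branchRing i) (FractionRing (C.branchRing i))

/-- The values `v(g) = (v₁(g), …, v_r(g))` of `g ∈ 𝒪`: `vᵢ(g)` is the value, under the normalized
discrete valuation of the integral closure of `𝒪ᵢ`, of the image of `g` in `𝒪ᵢ`. -/
noncomputable def val (g : C.localRing) (i : Fin r) : ℕ∞ :=
  normalizedVal
    (algebraMap (C.branchRing i) (C.branchClosure i)
      (Ideal.Quotient.factor (C.ideal_le_branch i) g))

/-- The set `I_g` of indices `i` with `vᵢ(g) ≠ ∞`. -/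
def finiteIndices (g : C.localRing) : Set (Fin r) := {i | C.val g i ≠ ⊤}

/-- The `G`-product `G^α`; only the exponents `α g` with `g ∈ G` matter. -/
noncomputable def prodPow (G : Finset C.localRing) (α : C.localRing → ℕ) : C.localRing :=
  ∏ g ∈ G, g ^ α g

/-- `h` is a `k`-reduction of `g` modulo `G` (used for `g ≠ 0` and `k ∈ I_g`). -/
def IsReductionAt (G : Finset C.localRing) (k : Fin r) (g h : C.localRing) : Prop :=
  ∃ (c : K) (α : C.localRing → ℕ), h = g - c • C.prodPow G α ∧
    (∀ i, C.val g i ≤ C.val h i) ∧ C.val g k < C.val h k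

/-- `h` is a reduction of `g` modulo `G`: a `k`-reduction for some `k ∈ I_g`. -/
def IsReduction (G : Finset C.localRing) (g h : C.localRing) : Prop :=
  ∃ k ∈ C.finiteIndices g, C.IsReductionAt G k g h

/-- `G` is a Standard Basis for `𝒪`: a nonempty finite subset of `ℳ ∖ {0}` modulo which every
nonzero element of `𝒪` has a reduction. -/
structure IsStandardBasis (G : Finset C.localRing) : Prop where
  nonempty : G.Nonempty
  mem_maximalIdeal : ∀ g ∈ G, g ∈ IsLocalRing.maximalIdeal C.localRing
  ne_zero : ∀ g ∈ G, g ≠ 0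
  exists_reduction : ∀ g : C.localRing, g ≠ 0 → ∃ h, C.IsReduction G g h

end AlgebroidCurve

/-! Leading terms decide everything. The integral closure of each branch is a discrete valuation
ring with residue field `K`, so when `g` and a `G`-product have the same finite value at `k`, a
scalar multiple of the product cancels the leading term of `g` at `k`; conversely, every reduction
displays such a product. All implications but 4 → 5 follow from this.

For 4 → 5 fix `k`. If the product `p` supplied by 4 matches `g` only at some other index `l`, then
`g - c • p` keeps the value at `k`, lowers no value and raises the one at `l`. Repetition must end,
because finite values cannot grow without bound: past a conductor bound, the component of `g` on a
branch other than `k` can be removed inside `𝒪`, making that value infinite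
(`exists_bound_val_sub_eq_top`). A bounded sum of truncated values measures the progress
(`exists_mem_val_le_and_val_eq`).

The facts about branches come from `K⟦X⟧ → 𝒪ᵢ`, with `X` sent to a nonzero element of the maximal
ideal (`branchClosure_structure`). Finiteness of the integral closure rests on comparing ranks and
on a complete form of Nakayama's lemma, so separability plays no role. -/

/-! ### Modules over `K⟦X⟧` and their reduction modulo `X` -/

open PowerSeries in
-- Complete Nakayama: lifts `e` of generators modulo `X` generate. Expanding `x` digit by digit
-- gives coefficients in `K⟦X⟧`, and separatedness kills the remainder.
theorem PowerSeries.moduleFinite_of_finite_quotient {K M : Type*} [Field K] [AddCommGroup M]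
    [Module K M] [Module K⟦X⟧ M] [IsScalarTower K K⟦X⟧ M]
    [IsHausdorff (Ideal.span {X} : Ideal K⟦X⟧) M]
    [Module.Finite K (M ⧸ (Ideal.span {(X : K⟦X⟧)} • ⊤ : Submodule K⟦X⟧ M))] :
    Module.Finite K⟦X⟧ M := by
  obtain ⟨d, s, hs⟩ := Module.Finite.exists_fin
    (R := K) (M := M ⧸ (Ideal.span {(X : K⟦X⟧)} • ⊤ : Submodule K⟦X⟧ M))
  choose e he using fun i => Submodule.Quotient.mk_surjective _ (s i)
  have hgen (x : M) : ∃ (c : Fin d → K) (y : M),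
      x = ∑ i, (C (c i) : K⟦X⟧) • e i + (X : K⟦X⟧) • y := by
    have hx : Submodule.Quotient.mk x ∈ Submodule.span K (Set.range s) := hs ▸ Submodule.mem_top
    obtain ⟨c, hc⟩ := (Submodule.mem_span_range_iff_exists_fun K).1 hx
    have hmem : x - ∑ i, c i • e i ∈ (Ideal.span {(X : K⟦X⟧)} • ⊤ : Submodule K⟦X⟧ M) := by
      rw [← Submodule.Quotient.mk_eq_zero, Submodule.Quotient.mk_sub, ← hc, sub_eq_zero,
        ← Submodule.mkQ_apply _ (∑ i, c i • e i), map_sum]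
      simp [← he]
    rw [Submodule.ideal_span_singleton_smul, Submodule.mem_smul_pointwise_iff_exists] at hmem
    obtain ⟨y, -, hy⟩ := hmem
    refine ⟨c, y, ?_⟩
    have hC (k : K) (m : M) : (C k : K⟦X⟧) • m = k • m := by
      rw [← mul_one (C k : K⟦X⟧), ← smul_eq_C_mul, smul_assoc, one_smul]
    simp [hy, hC]
  choose c y hy using hgen
  -- The `n`-th coefficient is the digit of the `n`-th remainder `y^[n] x`. Completeness enters
  -- here: any sequence of digits is a power series.
  let f (x : M) (i : Fin d) : K⟦X⟧ := PowerSeries.mk fun n => c (y^[n] x) i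
  let δ (x : M) : M := x - ∑ i, f x i • e i
  have hf (x : M) (i : Fin d) : f x i = C (c x i) + X * f (y x) i := by
    ext n
    cases n <;> simp [f, coeff_succ_X_mul]
  have hδ (x : M) : δ x = (X : K⟦X⟧) • δ (y x) := by
    simp only [δ, hf x, add_smul, Finset.sum_add_distrib, mul_smul, ← Finset.smul_sum]
    nth_rewrite 1 [hy x]
    rw [smul_sub]
    abel
  have hpow (n : ℕ) : ∀ x, δ x = (X ^ n : K⟦X⟧) • δ (y^[n] x) := by
    induction n with
    | zero => simp
    | succ n ih => intro x; rw [hδ, ih (y x), ← mul_smul, pow_succ', Function.iterate_succ_apply]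
  have hzero (x : M) : δ x = 0 := by
    refine IsHausdorff.haus (I := Ideal.span {(X : K⟦X⟧)}) ‹_› _ fun n => ?_
    rw [SModEq.zero, hpow n x]
    exact Submodule.smul_mem_smul (Ideal.pow_mem_pow (Ideal.mem_span_singleton_self _) n) trivial
  classical
  refine ⟨⟨Finset.univ.image e, top_le_iff.1 fun x _ => ?_⟩⟩
  rw [sub_eq_zero.1 (hzero x)]
  exact Submodule.sum_mem _ fun i _ =>
    Submodule.smul_mem _ _ (Submodule.subset_span (by simp))

open PowerSeries in
-- Independence modulo `X` kills the constant terms of a relation; torsion-freeness then allows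
-- division by `X`, and the argument repeats for every coefficient.
theorem PowerSeries.linearIndependent_of_mkQ {K M ι : Type*} [Field K] [AddCommGroup M]
    [Module K M] [Module K⟦X⟧ M] [IsScalarTower K K⟦X⟧ M] [Module.IsTorsionFree K⟦X⟧ M]
    {v : ι → M} (hv : LinearIndependent K fun i =>
      (Submodule.Quotient.mk (v i) : M ⧸ (Ideal.span {(X : K⟦X⟧)} • ⊤ : Submodule K⟦X⟧ M))) :
    LinearIndependent K⟦X⟧ v := by
  rw [linearIndependent_iff'] at hv ⊢
  intro s
  suffices ∀ (n : ℕ) (g : ι → K⟦X⟧), ∑ i ∈ s, g i • v i = 0 → ∀ i ∈ s, coeff n (g i) = 0 from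
    fun g hg i hi => PowerSeries.ext fun n => by simpa using this n g hg i hi
  have key (g : ι → K⟦X⟧) (hg : ∑ i ∈ s, g i • v i = 0) : ∀ i ∈ s, constantCoeff (g i) = 0 := by
    refine hv s _ ?_
    rw [← (Submodule.Quotient.mk_eq_zero (Ideal.span {(X : K⟦X⟧)} • ⊤ : Submodule K⟦X⟧ M)).2
      (hg ▸ Submodule.zero_mem _ : ∑ i ∈ s, g i • v i ∈ _), ← Submodule.mkQ_apply, map_sum]
    refine Finset.sum_congr rfl fun i _ => ?_
    rw [Submodule.mkQ_apply, ← Submodule.Quotient.mk_smul, Submodule.Quotient.eq]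
    have hC (k : K) (m : M) : (C k : K⟦X⟧) • m = k • m := by
      rw [← mul_one (C k : K⟦X⟧), ← smul_eq_C_mul, smul_assoc, one_smul]
    rw [← hC, ← sub_smul]
    refine Submodule.smul_mem_smul (Ideal.mem_span_singleton.2 ?_) trivial
    simp [X_dvd_iff]
  intro n
  induction n with
  | zero => simpa using key
  | succ n ih =>
    intro g hg
    have h0 := key g hg
    choose! g' hg' using fun i hi => X_dvd_iff.2 (h0 i hi)
    have : ∑ i ∈ s, g' i • v i = 0 := by
      refine (smul_eq_zero.1 (?_ : (X : K⟦X⟧) • ∑ i ∈ s, g' i • v i = 0)).resolve_left X_ne_zero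
      rw [Finset.smul_sum, ← hg]
      exact Finset.sum_congr rfl fun i hi => by rw [hg' i hi, mul_smul]
    intro i hi
    rw [hg' i hi, coeff_succ_X_mul]
    exact ih g' this i hi

open PowerSeries in
theorem PowerSeries.rank_quotient_le {K M : Type*} [Field K] [AddCommGroup M]
    [Module K M] [Module K⟦X⟧ M] [IsScalarTower K K⟦X⟧ M] [Module.IsTorsionFree K⟦X⟧ M] :
    Module.rank K (M ⧸ (Ideal.span {(X : K⟦X⟧)} • ⊤ : Submodule K⟦X⟧ M)) ≤ Module.rank K⟦X⟧ M := by
  rw [Module.rank_def]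
  refine ciSup_le' fun ⟨s, hs⟩ => ?_
  choose v hv using fun q : s => Submodule.Quotient.mk_surjective _ q.1
  refine (linearIndependent_of_mkQ (v := v) ?_).cardinal_le_rank
  simpa only [hv] using! hs

/-! ### Separatedness, finiteness and completeness -/

/-- A nonzero `x` in `B` divides some nonzero `r` in `A`. If `a ^ n` divides `x` in `B`, then `r / a
^ n` is integral over `A`, hence in `A`; Krull's intersection theorem in `A` forbids this for all
`n`. -/
theorem IsHausdorff.span_singleton_of_isIntegral {A B : Type*} [CommRing A] [IsDomain A]
    [IsNoetherianRing A] [IsIntegrallyClosed A]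
    [CommRing B] [IsDomain B] [Algebra A B] [Algebra.IsIntegral A B] [Module.IsTorsionFree A B]
    {a : A} (ha : ¬ IsUnit a) : IsHausdorff (Ideal.span {a}) B := by
  refine ⟨fun x hx => ?_⟩
  by_contra h0
  obtain ⟨r, hr, hxr⟩ := (Algebra.IsIntegral.isIntegral (R := A) x).isAlgebraic.exists_nonzero_dvd
    (mem_nonZeroDivisors_of_ne_zero h0)
  refine hr (IsHausdorff.haus (IsHausdorff.of_isDomain (Ideal.span {a})
    (by rwa [Ne, Ideal.span_singleton_eq_top])) r fun n => ?_)
  have := hx n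
  rw [SModEq.zero, Ideal.span_singleton_pow] at this ⊢
  rw [Submodule.ideal_span_singleton_smul, Submodule.mem_smul_pointwise_iff_exists] at this
  obtain ⟨y, -, rfl⟩ := this
  rw [smul_eq_mul, Ideal.mul_top, Ideal.mem_span_singleton]
  obtain ⟨z, hz⟩ := hxr
  by_cases han : a ^ n = 0
  · rw [han, zero_smul] at h0; exact absurd rfl h0
  let F := FractionRing A
  let L := FractionRing B
  have : FaithfulSMul A L := by
    rw [faithfulSMul_iff_algebraMap_injective, IsScalarTower.algebraMap_eq A B L]
    exact (IsFractionRing.injective B L).comp (FaithfulSMul.algebraMap_injective A B)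
  let : Algebra F L := FractionRing.liftAlgebra A L
  have : IsScalarTower A F L := FractionRing.isScalarTower_liftAlgebra A L
  have hint : IsIntegral A (algebraMap A F r / algebraMap A F (a ^ n)) := by
    rw [← isIntegral_algebraMap_iff (algebraMap F L).injective]
    have : algebraMap F L (algebraMap A F r / algebraMap A F (a ^ n)) =
        algebraMap B L (y * z) := by
      have h1 : algebraMap A L (a ^ n) ≠ 0 := by
        simpa only [map_zero] using (FaithfulSMul.algebraMap_injective A L).ne han
      rw [map_div₀, ← IsScalarTower.algebraMap_apply, ← IsScalarTower.algebraMap_apply,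
        div_eq_iff h1, IsScalarTower.algebraMap_apply A B L r, hz,
        IsScalarTower.algebraMap_apply A B L, ← map_mul, Algebra.smul_def]
      congr 1
      ring
    rw [this]
    exact (Algebra.IsIntegral.isIntegral (R := A) (y * z)).algebraMap
  obtain ⟨q, hq⟩ := IsIntegrallyClosed.isIntegral_iff.1 hint
  refine ⟨q, IsFractionRing.injective A F ?_⟩
  rw [map_mul, hq, mul_div_cancel₀]
  simpa only [map_zero] using (IsFractionRing.injective A F).ne han

open IsLocalRing

theorem Module.rank_fractionRing_lt_aleph0 (A R F : Type*) [CommRing A] [IsDomain A] [CommRing R]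
    [IsDomain R] [Field F] [Algebra A R] [Algebra R F] [Algebra A F] [IsScalarTower A R F]
    [IsFractionRing R F] [Module.Finite A R] [FaithfulSMul A R] :
    Module.rank A F < Cardinal.aleph0 := by
  have h : 0 < Module.finrank A F := by
    rw [← IsFractionRing.finrank_left_eq A (S := R) F]
    exact Module.finrank_pos
  exact (Cardinal.toNat_ne_zero.1 h.ne').2

theorem IsLocalRing.exists_finset_sub_mem_pow {K R : Type*} [Field K] [CommRing R] [IsLocalRing R]
    [IsNoetherianRing R] [Algebra K R]
    (hres : ∀ x : R, ∃ c : K, x - algebraMap K R c ∈ maximalIdeal R) (n : ℕ) :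
    ∃ s : Finset R, ∀ x : R, ∃ v ∈ Submodule.span K (s : Set R), x - v ∈ maximalIdeal R ^ n := by
  classical
  induction n with
  | zero => exact ⟨∅, fun x => ⟨0, Submodule.zero_mem _, by simp⟩⟩
  | succ n ih =>
    obtain ⟨s, hs⟩ := ih
    obtain ⟨t, ht⟩ := IsNoetherian.noetherian (maximalIdeal R ^ n)
    have key (y : R) (hy : y ∈ Submodule.span R (t : Set R)) :
        ∃ w ∈ Submodule.span K (t : Set R), y - w ∈ maximalIdeal R ^ (n + 1) := by
      induction hy using Submodule.span_induction with
      | mem y hy => exact ⟨y, Submodule.subset_span hy, by simp⟩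
      | zero => exact ⟨0, Submodule.zero_mem _, by simp⟩
      | add y z _ _ hy hz =>
        obtain ⟨v, hv, hv'⟩ := hy
        obtain ⟨w, hw, hw'⟩ := hz
        exact ⟨v + w, Submodule.add_mem _ hv hw, by
          simpa [add_sub_add_comm] using Ideal.add_mem _ hv' hw'⟩
      | smul r y hy ih =>
        obtain ⟨w, hw, hw'⟩ := ih
        obtain ⟨c, hc⟩ := hres r
        refine ⟨c • w, Submodule.smul_mem _ _ hw, ?_⟩
        have : r • y - c • w =
            (r - algebraMap K R c) * y + algebraMap K R c * (y - w) := by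
          rw [Algebra.smul_def c, smul_eq_mul]; ring
        rw [this]
        refine Ideal.add_mem _ ?_ (Ideal.mul_mem_left _ _ hw')
        rw [pow_succ']
        exact Ideal.mul_mem_mul hc (ht ▸ hy)
    refine ⟨s ∪ t, fun x => ?_⟩
    obtain ⟨v, hv, hv'⟩ := hs x
    obtain ⟨w, hw, hw'⟩ := key (x - v) (by rw [ht]; exact hv')
    refine ⟨v + w, ?_, by rwa [← sub_sub]⟩
    rw [Finset.coe_union]
    exact Submodule.add_mem _ (Submodule.span_mono Set.subset_union_left hv)
      (Submodule.span_mono Set.subset_union_right hw)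

/-- In dimension at most one a power of the maximal ideal lies in `(a)`, and modulo that power
everything is spanned over `K` by finitely many elements. -/
theorem IsLocalRing.finite_quotient_span_singleton {K R : Type*} [Field K] [CommRing R] [IsDomain R]
    [IsLocalRing R] [IsNoetherianRing R] [Ring.KrullDimLE 1 R] [Algebra K R]
    (hres : ∀ x : R, ∃ c : K, x - algebraMap K R c ∈ maximalIdeal R) {a : R} (ha : a ≠ 0) :
    Module.Finite K (R ⧸ Ideal.span {a}) := by
  obtain ⟨n, hn⟩ := Ideal.exists_pow_le_of_le_radical_of_fg
    (I := maximalIdeal R) (J := Ideal.span {a}) (by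
      rw [Ideal.radical_eq_sInf]
      refine le_sInf fun J ⟨hJ, hJp⟩ => ?_
      have hJ0 : J ≠ ⊥ := fun h => ha (by
        simpa [h] using hJ (Ideal.mem_span_singleton_self a))
      exact (eq_maximalIdeal (hJp.isMaximal_of_ne_bot hJ0)).ge)
    (IsNoetherian.noetherian _)
  obtain ⟨s, hs⟩ := exists_finset_sub_mem_pow hres n
  have hsp : Submodule.map (Ideal.Quotient.mkₐ K (Ideal.span {a})).toLinearMap
      (Submodule.span K (s : Set R)) = ⊤ := by
    refine top_le_iff.1 fun q _ => ?_
    obtain ⟨x, rfl⟩ := Ideal.Quotient.mk_surjective q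
    obtain ⟨v, hv, hv'⟩ := hs x
    exact ⟨v, hv, (Ideal.Quotient.eq.2 (hn hv')).symm⟩
  exact ⟨hsp ▸ (Submodule.fg_span s.finite_toSet).map _⟩

theorem IsAdicComplete.of_finite {A M : Type*} [CommRing A] (I : Ideal A)
    [AddCommGroup M] [Module A M] [IsAdicComplete I A] [Module.Finite A M] [IsHausdorff I M] :
    IsAdicComplete I M := by
  have : IsPrecomplete I M := by
    rw [← AdicCompletion.of_surjective_iff]
    intro q
    obtain ⟨t, rfl⟩ := AdicCompletion.ofTensorProduct_surjective_of_finite I M q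
    induction t with
    | zero => exact ⟨0, by simp⟩
    | add x y hx hy =>
      obtain ⟨x', hx'⟩ := hx
      obtain ⟨y', hy'⟩ := hy
      exact ⟨x' + y', by rw [map_add, hx', hy', map_add]⟩
    | tmul r m =>
      obtain ⟨r', rfl⟩ := AdicCompletion.of_surjective I A r
      refine ⟨r' • m, ?_⟩
      rw [AdicCompletion.ofTensorProduct_tmul, map_smul]
      ext n
      rfl
  exact {}

/-- Idempotents lift along `I`, and a domain has only `0` and `1`. In the Artinian quotient a power
of a multiple of `x` is idempotent: if it lifts to `1`, `x` is a unit; if to `0`, `x` is nilpotent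
modulo `I` and `1 - x` is a unit. -/
theorem HenselianRing.isLocalRing_of_isArtinianRing_quotient {B : Type*} [CommRing B] [IsDomain B]
    (I : Ideal B) [HenselianRing B I] [IsArtinianRing (B ⧸ I)] : IsLocalRing B := by
  have hunit {x : B} (hx : IsUnit (Ideal.Quotient.mk I x)) : IsUnit x := by
    have := isLocalHom_of_le_jacobson_bot I HenselianRing.jac
    exact hx.of_map
  refine IsLocalRing.of_isUnit_or_isUnit_one_sub_self fun x => ?_
  obtain ⟨n, z, hz⟩ := IsArtinian.exists_pow_succ_smul_dvd (M := B ⧸ I) (Ideal.Quotient.mk I x) 1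
  obtain ⟨y, rfl⟩ := Ideal.Quotient.mk_surjective z
  set u := Ideal.Quotient.mk I x
  set w := Ideal.Quotient.mk I y
  have h1 : u ^ (n + 1) * (u * w) = u ^ (n + 1) := by
    simp only [smul_eq_mul, mul_one] at hz
    rw [Nat.succ_eq_add_one, pow_succ, mul_assoc] at hz
    linear_combination u * hz
  have h2 (m : ℕ) : u ^ (n + 1) * (u * w) ^ m = u ^ (n + 1) := by
    induction m with
    | zero => simp
    | succ m ih => rw [pow_succ (u * w), ← mul_assoc, ih, h1]
  have he : (u * w) ^ (n + 1) * (u * w) ^ (n + 1) = (u * w) ^ (n + 1) := by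
    nth_rewrite 1 [mul_pow]
    rw [mul_right_comm, h2, ← mul_pow]
  obtain ⟨e, hroot, hmem⟩ := HenselianRing.is_henselian (I := I)
    (Polynomial.X ^ 2 - Polynomial.X : Polynomial B) (by monicity!) ((x * y) ^ (n + 1))
    (by
      rw [← Ideal.Quotient.eq_zero_iff_mem]
      simp only [Polynomial.eval_sub, Polynomial.eval_pow, Polynomial.eval_X, map_sub, map_pow,
        map_mul]
      rw [sq, he, sub_self])
    (by
      -- At an idempotent `ε` the derivative `2ε - 1` squares to `1`, so it is its own inverse.
      refine IsUnit.of_mul_eq_one (Ideal.Quotient.mk I (2 * (x * y) ^ (n + 1) - 1)) ?_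
      simp only [Polynomial.derivative_X_pow, Polynomial.derivative_X,
        Polynomial.eval_sub, Polynomial.eval_mul, Polynomial.eval_pow, Polynomial.eval_X,
        Polynomial.eval_one, map_sub, map_pow, map_mul, map_one]
      simp only [Nat.cast_ofNat, Polynomial.eval_ofNat, map_ofNat, Nat.reduceSub, pow_one]
      linear_combination 4 * he)
  have he01 : e = 0 ∨ e = 1 := by
    have : e * (e - 1) = 0 := by
      simpa [Polynomial.IsRoot, sq, mul_sub] using hroot
    simpa [sub_eq_zero] using this
  rw [← Ideal.Quotient.eq] at hmem
  rcases he01 with rfl | rfl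
  · right
    have hnil : IsNilpotent u := by
      refine ⟨n + 1, ?_⟩
      rw [← h2 (n + 1)]
      have : (u * w) ^ (n + 1) = 0 := by simpa using hmem.symm
      rw [this, mul_zero]
    exact hunit (by simpa using hnil.isUnit_one_sub)
  · left
    refine hunit (isUnit_of_mul_isUnit_left (y := w) ((isUnit_pow_iff (Nat.succ_ne_zero n)).1 ?_))
    have : (u * w) ^ (n + 1) = 1 := by simpa using hmem.symm
    rw [this]
    exact isUnit_one

open PowerSeries in
theorem PowerSeries.faithfulSMul_of_algebraMap_X_ne_zero {K R : Type*} [Field K] [CommRing R]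
    [IsDomain R] [Algebra K⟦X⟧ R] (hX : algebraMap K⟦X⟧ R X ≠ 0) : FaithfulSMul K⟦X⟧ R := by
  rw [faithfulSMul_iff_algebraMap_injective, RingHom.injective_iff_ker_eq_bot]
  by_contra h
  have hmax := (RingHom.ker_isPrime (algebraMap K⟦X⟧ R)).isMaximal h
  refine hX ?_
  rw [← RingHom.mem_ker, eq_maximalIdeal hmax, maximalIdeal_eq_span_X]
  exact Ideal.mem_span_singleton_self _

/-- A common denominator of finitely many module generators: a nonzero element of the conductor. -/
theorem IsFractionRing.exists_ne_zero_mul_eq_algebraMap (R B F : Type*) [CommRing R] [IsDomain R]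
    [CommRing B] [Field F] [Algebra R B] [Algebra R F] [Algebra B F] [IsScalarTower R B F]
    [FaithfulSMul B F] [IsFractionRing R F] [Module.Finite R B] :
    ∃ d : R, d ≠ 0 ∧ ∀ b : B, ∃ r : R, algebraMap R B d * b = algebraMap R B r := by
  obtain ⟨s, hs⟩ := Module.Finite.fg_top (R := R) (M := B)
  obtain ⟨d, hd⟩ := IsLocalization.exist_integer_multiples (nonZeroDivisors R) s (algebraMap B F)
  refine ⟨d, nonZeroDivisors.coe_ne_zero d, fun b => ?_⟩
  have hb : b ∈ Submodule.span R (s : Set B) := hs ▸ Submodule.mem_top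
  induction hb using Submodule.span_induction with
  | mem b hb =>
    obtain ⟨r, hr⟩ := hd b hb
    refine ⟨r, FaithfulSMul.algebraMap_injective B F ?_⟩
    rw [← IsScalarTower.algebraMap_apply, hr, map_mul, ← IsScalarTower.algebraMap_apply,
      Algebra.smul_def]
  | zero => exact ⟨0, by simp⟩
  | add x y _ _ hx hy =>
    obtain ⟨r, hr⟩ := hx
    obtain ⟨t, ht⟩ := hy
    exact ⟨r + t, by rw [mul_add, hr, ht, map_add]⟩
  | smul c x _ hx =>
    obtain ⟨r, hr⟩ := hx
    exact ⟨c * r, by rw [mul_smul_comm, hr, Algebra.smul_def, map_mul]⟩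

open PowerSeries in
theorem PowerSeries.moduleFinite_of_isLocalRing {K R : Type*} [Field K] [CommRing R] [IsDomain R]
    [IsLocalRing R] [IsNoetherianRing R] [Ring.KrullDimLE 1 R] [Algebra K R] [Algebra K⟦X⟧ R]
    [IsScalarTower K K⟦X⟧ R]
    (hres : ∀ x : R, ∃ c : K, x - algebraMap K R c ∈ maximalIdeal R)
    (hX : algebraMap K⟦X⟧ R X ≠ 0) (hXm : algebraMap K⟦X⟧ R X ∈ maximalIdeal R) :
    Module.Finite K⟦X⟧ R := by
  have hI : (Ideal.span {(X : K⟦X⟧)}).map (algebraMap K⟦X⟧ R) =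
      Ideal.span {algebraMap K⟦X⟧ R X} := by
    rw [Ideal.map_span, Set.image_singleton]
  have : IsHausdorff (Ideal.span {(X : K⟦X⟧)}) R := by
    rw [← IsHausdorff.map_algebraMap_iff (S := R), hI]
    exact IsHausdorff.of_isLocalRing _ _
      ((Ideal.ne_top_iff_exists_maximal).2 ⟨_, maximalIdeal.isMaximal R, by
        rwa [Ideal.span_le, Set.singleton_subset_iff]⟩)
  have hfin := finite_quotient_span_singleton hres hX
  have : Module.Finite K (R ⧸ (Ideal.span {(X : K⟦X⟧)} • ⊤ : Submodule K⟦X⟧ R)) := by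
    have heq : (Ideal.span {algebraMap K⟦X⟧ R X}).restrictScalars K =
        (Ideal.span {(X : K⟦X⟧)} • ⊤ : Submodule K⟦X⟧ R).restrictScalars K := by
      rw [Ideal.smul_top_eq_map, hI]
      rfl
    exact Module.Finite.equiv ((Submodule.Quotient.restrictScalarsEquiv K _).symm ≪≫ₗ
      Submodule.quotEquivOfEq _ _ heq ≪≫ₗ Submodule.Quotient.restrictScalarsEquiv K _)
  exact moduleFinite_of_finite_quotient

theorem FaithfulSMul.of_isFractionRing (A R B F : Type*) [CommRing A] [CommRing R] [CommRing B]
    [CommRing F] [Algebra A R] [Algebra A B] [Algebra R B] [Algebra R F] [Algebra B F]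
    [IsScalarTower A R B] [IsScalarTower R B F] [IsFractionRing R F] [FaithfulSMul A R] :
    FaithfulSMul A B := by
  rw [faithfulSMul_iff_algebraMap_injective, IsScalarTower.algebraMap_eq A R B]
  have h : Function.Injective (algebraMap R B) := by
    refine Function.Injective.of_comp (f := algebraMap B F) ?_
    rw [← RingHom.coe_comp, ← IsScalarTower.algebraMap_eq]
    exact IsFractionRing.injective R F
  exact h.comp (FaithfulSMul.algebraMap_injective A R)

/-! ### The integral closure of a finite `K⟦X⟧`-algebra -/

section

variable {K : Type*} (R : Type*) {B : Type*} (F : Type*) [Field K] [CommRing R] [IsDomain R]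
  [CommRing B] [IsDomain B] [Field F]
  [Algebra K B] [Algebra (PowerSeries K) R] [Algebra (PowerSeries K) B]
  [Algebra (PowerSeries K) F] [Algebra R F] [Algebra B F] [IsScalarTower K (PowerSeries K) B]
  [IsScalarTower (PowerSeries K) R F] [IsScalarTower (PowerSeries K) B F]
  [IsFractionRing R F] [IsIntegralClosure B R F]
  [Module.Finite (PowerSeries K) R] [FaithfulSMul (PowerSeries K) R]

open PowerSeries

include R F

/-- The dimension of `B / XB` is at most the rank of `B`, which is at most that of `F`; the latter
is finite because `R` is finite over `K⟦X⟧`. Finiteness of `B` is not needed yet, and follows from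
this. -/
theorem PowerSeries.finite_quotient_integralClosure [FaithfulSMul K⟦X⟧ B] :
    Module.Finite K (B ⧸ (Ideal.span {(X : K⟦X⟧)} • ⊤ : Submodule K⟦X⟧ B)) := by
  rw [← Module.rank_lt_aleph0_iff]
  have h1 : Module.rank K⟦X⟧ B < Cardinal.aleph0 := by
    have := LinearMap.lift_rank_le_of_injective (IsScalarTower.toAlgHom K⟦X⟧ B F).toLinearMap
      (IsIntegralClosure.algebraMap_injective B R F)
    rw [← Cardinal.lift_lt_aleph0]
    exact this.trans_lt (Cardinal.lift_lt_aleph0.2 (Module.rank_fractionRing_lt_aleph0 K⟦X⟧ R F))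
  exact PowerSeries.rank_quotient_le.trans_lt h1

variable [Algebra R B] [IsScalarTower (PowerSeries K) R B] [IsScalarTower R B F]

set_option linter.unusedSectionVars false in
theorem PowerSeries.isHausdorff_integralClosure : IsHausdorff (Ideal.span {(X : K⟦X⟧)}) B := by
  have : FaithfulSMul K⟦X⟧ B := .of_isFractionRing _ R _ F
  have : Algebra.IsIntegral R B := IsIntegralClosure.isIntegral_algebra R F
  have : Algebra.IsIntegral K⟦X⟧ B := Algebra.IsIntegral.trans R
  exact IsHausdorff.span_singleton_of_isIntegral X_prime.not_isUnit

theorem PowerSeries.moduleFinite_integralClosure : Module.Finite K⟦X⟧ B := by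
  have : FaithfulSMul K⟦X⟧ B := .of_isFractionRing _ R _ F
  have : IsHausdorff (Ideal.span {(X : K⟦X⟧)}) B := isHausdorff_integralClosure R F
  have : Module.Finite K (B ⧸ (Ideal.span {(X : K⟦X⟧)} • ⊤ : Submodule K⟦X⟧ B)) :=
    finite_quotient_integralClosure R F
  exact moduleFinite_of_finite_quotient

theorem PowerSeries.not_isUnit_algebraMap_X_integralClosure :
    ¬ IsUnit (algebraMap K⟦X⟧ B X) := by
  have : IsHausdorff (Ideal.span {(X : K⟦X⟧)}) B := isHausdorff_integralClosure R F
  intro h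
  refine one_ne_zero (α := B) (IsHausdorff.haus this 1 fun n => ?_)
  rw [SModEq.zero]
  obtain ⟨z, hz⟩ := (h.pow n).exists_right_inv
  rw [← hz, ← map_pow, ← Algebra.smul_def]
  exact Submodule.smul_mem_smul (Ideal.pow_mem_pow (Ideal.mem_span_singleton_self _) n) trivial

theorem PowerSeries.finite_ringQuotient_integralClosure :
    Module.Finite K (B ⧸ Ideal.span {algebraMap K⟦X⟧ B X}) := by
  have : FaithfulSMul K⟦X⟧ B := .of_isFractionRing _ R _ F
  have hfin : Module.Finite K (B ⧸ (Ideal.span {(X : K⟦X⟧)} • ⊤ : Submodule K⟦X⟧ B)) :=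
    finite_quotient_integralClosure R F
  have heq : (Ideal.span {algebraMap K⟦X⟧ B X}).restrictScalars K =
      (Ideal.span {(X : K⟦X⟧)} • ⊤ : Submodule K⟦X⟧ B).restrictScalars K := by
    rw [Ideal.smul_top_eq_map, Ideal.map_span, Set.image_singleton]
    rfl
  exact Module.Finite.equiv ((Submodule.Quotient.restrictScalarsEquiv K _).symm ≪≫ₗ
    Submodule.quotEquivOfEq _ _ heq.symm ≪≫ₗ Submodule.Quotient.restrictScalarsEquiv K _)

variable (K) in
include K in
theorem PowerSeries.isDiscreteValuationRing_integralClosure [IsIntegrallyClosed B] :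
    IsDiscreteValuationRing B := by
  have : FaithfulSMul K⟦X⟧ B := .of_isFractionRing _ R _ F
  have : Module.Finite K⟦X⟧ B := moduleFinite_integralClosure R F
  have : IsNoetherianRing B := IsNoetherianRing.of_finite K⟦X⟧ B
  have : Algebra.IsIntegral K⟦X⟧ B := Algebra.IsIntegral.of_finite _ _
  have : Ring.DimensionLEOne B := Ring.DimensionLEOne.of_isIntegral K⟦X⟧ B
  have : IsHausdorff (Ideal.span {(X : K⟦X⟧)}) B := isHausdorff_integralClosure R F
  have : Module.Finite K (B ⧸ Ideal.span {algebraMap K⟦X⟧ B X}) :=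
    finite_ringQuotient_integralClosure R F
  have : IsArtinianRing (B ⧸ Ideal.span {algebraMap K⟦X⟧ B X}) := IsArtinianRing.of_finite K _
  -- Being finite and separated over `K⟦X⟧`, `B` is complete, hence Henselian along `X`; this makes
  -- it local.
  have : IsAdicComplete (Ideal.span {algebraMap K⟦X⟧ B X}) B := by
    have := (IsAdicComplete.map_algebraMap_iff (S := B) _ _).2
      (IsAdicComplete.of_finite (Ideal.span {(X : K⟦X⟧)}) (M := B))
    rwa [Ideal.map_span, Set.image_singleton] at this
  have : IsLocalRing B :=
    HenselianRing.isLocalRing_of_isArtinianRing_quotient (Ideal.span {algebraMap K⟦X⟧ B X})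
  have hB : ¬ IsField B := fun h => by
    let := h.toField
    refine not_isUnit_algebraMap_X_integralClosure (K := K) (B := B) R F (IsUnit.mk0 _ ?_)
    simpa only [map_zero] using (FaithfulSMul.algebraMap_injective K⟦X⟧ B).ne X_ne_zero
  have : IsDedekindDomain B := { __ := (inferInstance : IsIntegrallyClosed B) }
  exact ((IsDiscreteValuationRing.TFAE B hB).out 0 2).2 this

theorem PowerSeries.exists_not_isUnit_sub_integralClosure [IsAlgClosed K] [IsLocalRing B] (b : B) :
    ∃ c : K, ¬ IsUnit (b - algebraMap K B c) := by
  have hfin : Module.Finite K (B ⧸ Ideal.span {algebraMap K⟦X⟧ B X}) :=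
    finite_ringQuotient_integralClosure R F
  have hle : Ideal.span {algebraMap K⟦X⟧ B X} ≤ maximalIdeal B := by
    rw [Ideal.span_le, Set.singleton_subset_iff]
    exact not_isUnit_algebraMap_X_integralClosure (K := K) (B := B) R F
  have : Module.Finite K (B ⧸ maximalIdeal B) :=
    Module.Finite.of_surjective (Ideal.Quotient.factorₐ K hle).toLinearMap
      (Ideal.Quotient.factor_surjective hle)
  have : Algebra.IsIntegral K (B ⧸ maximalIdeal B) := Algebra.IsIntegral.of_finite _ _
  obtain ⟨c, hc⟩ := (IsAlgClosed.algebraMap_bijective_of_isIntegral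
    (k := K) (K := B ⧸ maximalIdeal B)).2 (Ideal.Quotient.mk _ b)
  exact ⟨c, Ideal.Quotient.eq.1 hc.symm⟩

end

open PowerSeries in
theorem PowerSeries.integralClosure_structure {K R : Type*} [Field K] [IsAlgClosed K] [CommRing R]
    [IsDomain R] [IsLocalRing R] [IsNoetherianRing R] [Ring.KrullDimLE 1 R] [Algebra K R]
    (hres : ∀ x : R, ∃ c : K, x - algebraMap K R c ∈ maximalIdeal R) (φ : K⟦X⟧ →ₐ[K] R)
    (hX : φ X ≠ 0) (hXm : φ X ∈ maximalIdeal R) :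
    IsDiscreteValuationRing (integralClosure R (FractionRing R)) ∧
    (∀ b : integralClosure R (FractionRing R), ∃ c : K,
      ¬ IsUnit (b - algebraMap K (integralClosure R (FractionRing R)) c)) ∧
    ∃ d : R, d ≠ 0 ∧ ∀ b : integralClosure R (FractionRing R), ∃ r : R,
      algebraMap R _ d * b = algebraMap R (integralClosure R (FractionRing R)) r := by
  let := φ.toRingHom.toAlgebra
  have : IsScalarTower K K⟦X⟧ R := IsScalarTower.of_algebraMap_eq fun c => (φ.commutes c).symm
  have : FaithfulSMul K⟦X⟧ R := faithfulSMul_of_algebraMap_X_ne_zero hX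
  have : Module.Finite K⟦X⟧ R := moduleFinite_of_isLocalRing hres hX hXm
  have : IsScalarTower K K⟦X⟧ (FractionRing R) := .of_algebraMap_eq fun c => by
    rw [IsScalarTower.algebraMap_apply K R (FractionRing R), IsScalarTower.algebraMap_apply K K⟦X⟧ R,
      ← IsScalarTower.algebraMap_apply K⟦X⟧ R (FractionRing R)]
  have : IsScalarTower K K⟦X⟧ (integralClosure R (FractionRing R)) :=
    .of_algebraMap_eq fun c => Subtype.ext (IsScalarTower.algebraMap_apply K K⟦X⟧ (FractionRing R) c)
  have : IsScalarTower K⟦X⟧ R (integralClosure R (FractionRing R)) :=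
    .of_algebraMap_eq fun c => Subtype.ext (IsScalarTower.algebraMap_apply K⟦X⟧ R (FractionRing R) c)
  have : IsScalarTower K⟦X⟧ (integralClosure R (FractionRing R)) (FractionRing R) :=
    .of_algebraMap_eq fun c => rfl
  have : IsIntegrallyClosed (integralClosure R (FractionRing R)) :=
    integralClosure.isIntegrallyClosedOfFiniteExtension (FractionRing R)
  have hdvr := isDiscreteValuationRing_integralClosure K R (FractionRing R)
    (B := integralClosure R (FractionRing R))
  have : Module.Finite K⟦X⟧ (integralClosure R (FractionRing R)) :=
    moduleFinite_integralClosure R (FractionRing R)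
  have : Module.Finite R (integralClosure R (FractionRing R)) :=
    Module.Finite.of_restrictScalars_finite K⟦X⟧ R _
  exact ⟨hdvr, exists_not_isUnit_sub_integralClosure R (FractionRing R),
    IsFractionRing.exists_ne_zero_mul_eq_algebraMap R _ (FractionRing R)⟩

/-! ### Normalization of a branch -/

namespace AlgebroidCurve

variable {K : Type*} [Field K] {n r : ℕ} (C : AlgebroidCurve K n r)

instance isPrime_branch (i : Fin r) : (C.branch i).IsPrime := by
  have h : C.branch i ∈ C.ideal.minimalPrimes := C.range_branch ▸ Set.mem_range_self i
  exact h.1.1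

instance isLocalRing_branchRing (i : Fin r) : IsLocalRing (C.branchRing i) :=
  IsLocalRing.of_surjective' (Ideal.Quotient.mk (C.branch i)) Ideal.Quotient.mk_surjective

theorem branchClosure_structure [IsAlgClosed K] (i : Fin r) :
    IsDiscreteValuationRing (C.branchClosure i) ∧
    (∀ b : C.branchClosure i, ∃ c : K, ¬ IsUnit (b - algebraMap K (C.branchClosure i) c)) ∧
    ∃ d : C.branchRing i, d ≠ 0 ∧ ∀ b : C.branchClosure i, ∃ r : C.branchRing i,
      algebraMap _ _ d * b = algebraMap (C.branchRing i) (C.branchClosure i) r := by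
  have hmem {x : MvPowerSeries (Fin n) K} (hx : MvPowerSeries.constantCoeff x = 0) :
      Ideal.Quotient.mk (C.branch i) x ∈ maximalIdeal (C.branchRing i) := by
    refine (mem_maximalIdeal _).2 fun h => ?_
    have := IsLocalHom.of_surjective (Ideal.Quotient.mk (C.branch i)) Ideal.Quotient.mk_surjective
    have hu := MvPowerSeries.isUnit_iff_constantCoeff.1
      (h.of_map (f := Ideal.Quotient.mk (C.branch i)))
    rw [hx] at hu
    exact not_isUnit_zero hu
  have : Ring.KrullDimLE 1 (C.branchRing i) := Ring.krullDimLE_iff.2 (C.ringKrullDim_branch i).le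
  have hfield : maximalIdeal (C.branchRing i) ≠ ⊥ := fun h => by
    have := ringKrullDim_eq_zero_of_isField (isField_iff_maximalIdeal_eq.2 h)
    rw [C.ringKrullDim_branch i] at this
    exact one_ne_zero this
  -- Dimension one excludes a field, so a nonzero nonunit exists; its lift `s` has zero constant
  -- term and can be substituted for `X`.
  obtain ⟨a, ha, ha0⟩ := Submodule.exists_mem_ne_zero_of_ne_bot hfield
  obtain ⟨s, rfl⟩ := Ideal.Quotient.mk_surjective a
  have hs : MvPowerSeries.constantCoeff s = 0 := by
    by_contra h
    exact (mem_maximalIdeal _).1 ha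
      ((MvPowerSeries.isUnit_iff_constantCoeff.2 (isUnit_iff_ne_zero.2 h)).map _)
  have hsub : PowerSeries.HasSubst s := PowerSeries.HasSubst.of_constantCoeff_zero hs
  have hφ : ((Ideal.Quotient.mkₐ K (C.branch i)).comp (PowerSeries.substAlgHom hsub))
      (PowerSeries.X : PowerSeries K) = Ideal.Quotient.mk (C.branch i) s := by
    rw [AlgHom.comp_apply, PowerSeries.substAlgHom_X hsub]
    rfl
  refine PowerSeries.integralClosure_structure ?_
    ((Ideal.Quotient.mkₐ K (C.branch i)).comp (PowerSeries.substAlgHom hsub))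
    (by rwa [hφ]) (by rwa [hφ])
  intro x
  obtain ⟨x, rfl⟩ := Ideal.Quotient.mk_surjective x
  refine ⟨MvPowerSeries.constantCoeff x, ?_⟩
  have := hmem (x := x - MvPowerSeries.C (MvPowerSeries.constantCoeff x)) (by simp)
  rwa [map_sub] at this

end AlgebroidCurve

/-! ### Values on the branches -/

namespace AlgebroidCurve

variable {K : Type*} [Field K] {n r : ℕ} (C : AlgebroidCurve K n r)

/-- The map from the local ring of the curve to the integral closure of the `i`-th branch. -/
noncomputable def toBranchClosure (i : Fin r) : C.localRing →ₐ[K] C.branchClosure i :=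
  (IsScalarTower.toAlgHom K (C.branchRing i) (C.branchClosure i)).comp
    (Ideal.Quotient.factorₐ K (C.ideal_le_branch i))

theorem toBranchClosure_eq_zero_iff {i : Fin r} {g : C.localRing} :
    C.toBranchClosure i g = 0 ↔ Ideal.Quotient.factor (C.ideal_le_branch i) g = 0 :=
  map_eq_zero_iff (algebraMap (C.branchRing i) (C.branchClosure i))
    (FaithfulSMul.algebraMap_injective _ _)

theorem val_eq_normalizedVal (g : C.localRing) (i : Fin r) :
    C.val g i = normalizedVal (C.toBranchClosure i g) := rfl

theorem exists_mem_branch_notMem_branch (i : Fin r) :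
    ∃ a, (∀ j, j ≠ i → a ∈ C.branch j) ∧ a ∉ C.branch i := by
  by_contra! h
  have hle : (Finset.univ.erase i).inf C.branch ≤ C.branch i := fun a ha =>
    h a fun j hj => (Finset.inf_le (f := C.branch) (by simpa using hj)) ha
  obtain ⟨j, hj, hji⟩ := (C.isPrime_branch i).inf_le'.1 hle
  have hi : C.branch i ∈ C.ideal.minimalPrimes := C.range_branch ▸ Set.mem_range_self i
  have hij := hi.2 ⟨C.isPrime_branch j, C.ideal_le_branch j⟩ hji
  exact (Finset.mem_erase.1 hj).1 (C.branch_injective (le_antisymm hji hij))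

section

variable [IsAlgClosed K]

instance isDiscreteValuationRing_branchClosure (i : Fin r) :
    IsDiscreteValuationRing (C.branchClosure i) :=
  (C.branchClosure_structure i).1

theorem val_eq_addVal (g : C.localRing) (i : Fin r) :
    C.val g i = IsDiscreteValuationRing.addVal _ (C.toBranchClosure i g) :=
  normalizedVal_eq_addVal _

theorem val_eq_top_iff {g : C.localRing} {i : Fin r} :
    C.val g i = ⊤ ↔ Ideal.Quotient.factor (C.ideal_le_branch i) g = 0 := by
  rw [val_eq_addVal, IsDiscreteValuationRing.addVal_eq_top_iff, toBranchClosure_eq_zero_iff]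

theorem min_val_le_val_add (g h : C.localRing) (i : Fin r) :
    min (C.val g i) (C.val h i) ≤ C.val (g + h) i := by
  simp only [val_eq_addVal, map_add]
  exact IsDiscreteValuationRing.addVal_add

theorem val_le_val_smul (c : K) (g : C.localRing) (i : Fin r) : C.val g i ≤ C.val (c • g) i := by
  rw [val_eq_addVal, val_eq_addVal, map_smul, Algebra.smul_def,
    IsDiscreteValuationRing.addVal_mul]
  exact le_add_self

theorem min_val_le_val_sub (g h : C.localRing) (i : Fin r) :
    min (C.val g i) (C.val h i) ≤ C.val (g - h) i := by
  rw [sub_eq_add_neg, ← neg_one_smul K h]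
  exact (min_le_min_left _ (C.val_le_val_smul _ _ _)).trans (C.min_val_le_val_add _ _ _)

theorem val_sub_of_val_eq_top (g : C.localRing) {h : C.localRing} {i : Fin r}
    (hh : C.val h i = ⊤) : C.val (g - h) i = C.val g i := by
  refine le_antisymm ?_ ?_
  · simpa [hh] using C.min_val_le_val_add (g - h) h i
  · simpa [hh] using C.min_val_le_val_sub g h i

/-- The ideal is radical, so an element vanishing on every branch is zero. -/
theorem finiteIndices_nonempty {g : C.localRing} (hg : g ≠ 0) : (C.finiteIndices g).Nonempty := by
  rw [Set.nonempty_iff_ne_empty]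
  intro h
  obtain ⟨s, rfl⟩ := Ideal.Quotient.mk_surjective g
  refine hg (Ideal.Quotient.eq_zero_iff_mem.2 ?_)
  rw [← C.isRadical.radical, ← Ideal.sInf_minimalPrimes, ← C.range_branch, Ideal.mem_sInf]
  rintro _ ⟨i, rfl⟩
  have hi : i ∉ C.finiteIndices (Ideal.Quotient.mk C.ideal s) := by simp [h]
  rw [finiteIndices, Set.mem_ofPred_eq, not_not, val_eq_top_iff] at hi
  exact Ideal.Quotient.eq_zero_iff_mem.1 hi

theorem exists_val_lt_val_sub_smul {g h : C.localRing} {i : Fin r} (hgh : C.val g i = C.val h i)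
    (hg : C.val g i ≠ ⊤) : ∃ c : K, C.val g i < C.val (g - c • h) i := by
  have hass := hgh
  rw [val_eq_addVal, val_eq_addVal, IsDiscreteValuationRing.addVal_eq_iff_associated] at hass
  obtain ⟨u, hu⟩ := hass.symm
  obtain ⟨c, hc⟩ := (C.branchClosure_structure i).2.1 (u : C.branchClosure i)
  refine ⟨c, ?_⟩
  have heq : C.toBranchClosure i (g - c • h) =
      C.toBranchClosure i h * (u - algebraMap K (C.branchClosure i) c) := by
    rw [map_sub, map_smul, ← hu, mul_sub, Algebra.smul_def, mul_comm (algebraMap K _ c)]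
  rw [C.val_eq_addVal (g - c • h), heq, IsDiscreteValuationRing.addVal_mul, ← val_eq_addVal, ← hgh]
  rw [← IsDiscreteValuationRing.addVal_eq_zero_iff] at hc
  simpa using (ENat.add_lt_add_iff_left hg).2 (pos_of_ne_zero hc)

/-- Let `a` vanish on all branches but the `i`-th, and let `d` lie in the conductor of that branch.
Any multiple of `a * d` in the closure equals, on branch `i`, some `a * s` coming from `𝒪`, which is
zero on the other branches. So `N` is the value of `a * d`. -/
theorem exists_bound_val_sub_eq_top (i : Fin r) :
    ∃ N : ℕ, ∀ g : C.localRing, (N : ℕ∞) ≤ C.val g i →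
      ∃ p : C.localRing, (∀ j, j ≠ i → C.val p j = ⊤) ∧ C.val (g - p) i = ⊤ := by
  obtain ⟨a, ha, hai⟩ := C.exists_mem_branch_notMem_branch i
  obtain ⟨d, hd, hb⟩ := (C.branchClosure_structure i).2.2
  set x : C.branchRing i := Ideal.Quotient.mk (C.branch i) a * d with hx
  have hx0 : x ≠ 0 := mul_ne_zero (fun h => hai (Ideal.Quotient.eq_zero_iff_mem.1 h)) hd
  have hx1 : IsDiscreteValuationRing.addVal _ (algebraMap _ (C.branchClosure i) x) ≠ ⊤ := by
    rw [Ne, IsDiscreteValuationRing.addVal_eq_top_iff]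
    simpa only [map_zero] using
      (FaithfulSMul.algebraMap_injective (C.branchRing i) (C.branchClosure i)).ne hx0
  obtain ⟨N, hN⟩ := ENat.ne_top_iff_exists.1 hx1
  refine ⟨N, fun g hg => ?_⟩
  rw [val_eq_addVal, hN, IsDiscreteValuationRing.addVal_le_iff_dvd] at hg
  obtain ⟨b, hg⟩ := hg
  obtain ⟨y, hy⟩ := hb b
  obtain ⟨s, rfl⟩ := Ideal.Quotient.mk_surjective y
  refine ⟨Ideal.Quotient.mk _ (a * s), fun j hj => ?_, ?_⟩
  · rw [val_eq_top_iff, Ideal.Quotient.factor_mk, Ideal.Quotient.eq_zero_iff_mem]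
    exact Ideal.mul_mem_right _ _ (ha j hj)
  · rw [val_eq_addVal, IsDiscreteValuationRing.addVal_eq_top_iff, map_sub, hg, hx, map_mul,
      mul_assoc, hy, ← map_mul, ← map_mul, sub_eq_zero]
    rfl

end

end AlgebroidCurve

/-- The order-preserving map `ℕ∞ → ℕ` truncating finite values at `N` and sending `⊤` to `N + 1`. -/
noncomputable def ENat.truncate (N : ℕ) (v : ℕ∞) : ℕ :=
  if v = ⊤ then N + 1 else min v.toNat N

theorem ENat.truncate_le (N : ℕ) (v : ℕ∞) : ENat.truncate N v ≤ N + 1 := by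
  unfold truncate
  split_ifs <;> omega

theorem ENat.truncate_mono (N : ℕ) : Monotone (ENat.truncate N) := by
  intro v w h
  induction v <;> induction w <;> simp_all [truncate]

theorem ENat.truncate_lt_truncate {N : ℕ} {v w : ℕ∞} (h : v < w) (hN : v < N ∨ w = ⊤) :
    ENat.truncate N v < ENat.truncate N w := by
  induction v <;> induction w <;> simp_all [truncate]

/-! ### From one index to all indices -/

namespace AlgebroidCurve

variable {K : Type*} [Field K] [IsAlgClosed K] {n r : ℕ} (C : AlgebroidCurve K n r)

theorem exists_mem_val_le_and_val_eq {P : Set C.localRing}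
    (hP : ∀ g : C.localRing, g ≠ 0 → ∃ l ∈ C.finiteIndices g, ∃ p ∈ P,
      (∀ i, C.val g i ≤ C.val p i) ∧ C.val g l = C.val p l)
    (g : C.localRing) {k : Fin r} (hk : k ∈ C.finiteIndices g) :
    ∃ p ∈ P, (∀ i, C.val g i ≤ C.val p i) ∧ C.val g k = C.val p k := by
  choose N hN using C.exists_bound_val_sub_eq_top
  obtain ⟨m, hm⟩ := ENat.ne_top_iff_exists.1 (show C.val g k ≠ ⊤ from hk)
  -- `N i` makes removal of a component possible; `m + 1` keeps the value `m` at `k` below the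
  -- threshold, so branch `k` is never removed.
  let M (i : Fin r) : ℕ := max (N i) (m + 1)
  let Φ (h : C.localRing) : ℕ := ∑ i, ENat.truncate (M i) (C.val h i)
  have hΦle (h : C.localRing) : Φ h ≤ ∑ i, (M i + 1) :=
    Finset.sum_le_sum fun i _ => ENat.truncate_le _ _
  have hΦlt {h h' : C.localRing} (hle : ∀ i, C.val h i ≤ C.val h' i) (l : Fin r)
      (hl : C.val h l < C.val h' l) (hl' : C.val h l < M l ∨ C.val h' l = ⊤) : Φ h < Φ h' :=
    Finset.sum_lt_sum (fun i _ => ENat.truncate_mono _ (hle i))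
      ⟨l, Finset.mem_univ l, ENat.truncate_lt_truncate hl hl'⟩
  clear hk
  induction hd : ∑ i, (M i + 1) - Φ g using Nat.strong_induction_on generalizing g with
  | _ d ih =>
    have step (h : C.localRing) (hle : ∀ i, C.val g i ≤ C.val h i) (hhk : C.val h k = C.val g k)
        (hlt : Φ g < Φ h) : ∃ p ∈ P, (∀ i, C.val g i ≤ C.val p i) ∧ C.val g k = C.val p k := by
      have := hΦle h
      obtain ⟨p, hp, hp1, hp2⟩ := ih _ (by omega) h (hm.trans hhk.symm) rfl
      exact ⟨p, hp, fun i => (hle i).trans (hp1 i), hhk.symm.trans hp2⟩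
    -- If a finite value has reached its threshold, truncation no longer sees it grow, so it is sent
    -- to `⊤` at once.
    by_cases hbig : ∃ i, (M i : ℕ∞) ≤ C.val g i ∧ C.val g i ≠ ⊤
    · obtain ⟨i, hi, hi'⟩ := hbig
      have hik : k ≠ i := by
        rintro rfl
        rw [← hm, Nat.cast_le] at hi
        exact absurd hi (by simp [M])
      obtain ⟨p, hp, hpi⟩ := hN i g (le_trans (by simp [M]) hi)
      have hval (j : Fin r) (hj : j ≠ i) : C.val (g - p) j = C.val g j :=
        C.val_sub_of_val_eq_top g (hp j hj)
      have hle (j : Fin r) : C.val g j ≤ C.val (g - p) j := by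
        by_cases hj : j = i
        · rw [hj, hpi]; exact le_top
        · exact (hval j hj).ge
      exact step (g - p) hle (hval k hik) (hΦlt hle i (hpi ▸ hi'.lt_top) (Or.inr hpi))
    · push Not at hbig
      have hg0 : g ≠ 0 := by
        rintro rfl
        have : C.val 0 k = ⊤ := C.val_eq_top_iff.2 (map_zero _)
        simp [this] at hm
      obtain ⟨l, hl, p, hp, hle, heq⟩ := hP g hg0
      by_cases hpk : C.val g k = C.val p k
      · exact ⟨p, hp, hle, hpk⟩
      obtain ⟨c, hc⟩ := C.exists_val_lt_val_sub_smul heq hl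
      have hcp (i : Fin r) : C.val p i ≤ C.val (c • p) i := C.val_le_val_smul c p i
      have hle' (i : Fin r) : C.val g i ≤ C.val (g - c • p) i :=
        (le_min le_rfl ((hle i).trans (hcp i))).trans (C.min_val_le_val_sub _ _ _)
      refine step (g - c • p) hle' ?_ (hΦlt hle' l hc (Or.inl ?_))
      -- If the value at `k` rose, then `g = (g - c • p) + c • p` would be a sum of two terms of
      -- larger value at `k`.
      · by_contra hne
        have h1 := C.min_val_le_val_add (g - c • p) (c • p) k
        rw [sub_add_cancel] at h1
        refine h1.not_gt (lt_min ((hle' k).lt_of_ne' hne) ?_)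
        exact ((hle k).lt_of_ne hpk).trans_le (hcp k)
      · by_contra hMl
        exact hl (hbig l (not_lt.1 hMl))

theorem exists_isReductionAt_of_val {G : Finset C.localRing} {g : C.localRing} {k : Fin r}
    (hk : k ∈ C.finiteIndices g) {α : C.localRing → ℕ}
    (hle : ∀ i, C.val g i ≤ C.val (C.prodPow G α) i)
    (heq : C.val g k = C.val (C.prodPow G α) k) : ∃ h, C.IsReductionAt G k g h := by
  obtain ⟨c, hc⟩ := C.exists_val_lt_val_sub_smul heq hk
  exact ⟨_, c, α, rfl, fun i => (le_min le_rfl ((hle i).trans (C.val_le_val_smul c _ i))).trans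
    (C.min_val_le_val_sub _ _ _), hc⟩

theorem IsReductionAt.exists_val {C : AlgebroidCurve K n r} {G : Finset C.localRing} {k : Fin r}
    {g h : C.localRing} (H : C.IsReductionAt G k g h) : ∃ α : C.localRing → ℕ,
      (∀ i, C.val g i ≤ C.val (C.prodPow G α) i) ∧ C.val g k = C.val (C.prodPow G α) k := by
  obtain ⟨c, α, rfl, hle, hlt⟩ := H
  -- With `c = 0` nothing changes and the value at `k` could not rise; so `p` is a scalar multiple
  -- of `g - h`.
  have hc : c ≠ 0 := by
    rintro rfl
    simp at hlt
  set p := C.prodPow G α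
  have hle' (i : Fin r) : C.val g i ≤ C.val p i := by
    have h1 := C.min_val_le_val_sub g (g - c • p) i
    have h2 := C.val_le_val_smul c⁻¹ (c • p) i
    rw [smul_smul, inv_mul_cancel₀ hc, one_smul] at h2
    rw [sub_sub_cancel, min_eq_left (hle i)] at h1
    exact h1.trans h2
  refine ⟨α, hle', (hle' k).antisymm (not_lt.1 fun h => ?_)⟩
  have h1 := C.min_val_le_val_add (g - c • p) (c • p) k
  rw [sub_add_cancel] at h1
  exact h1.not_gt (lt_min hlt (h.trans_le (C.val_le_val_smul c p k)))

end AlgebroidCurve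

theorem proposition8 {K : Type*} [Field K] [IsAlgClosed K] {n r : ℕ} (C : AlgebroidCurve K n r)
    (G : Finset C.localRing) (hG : G.Nonempty)
    (hGM : ∀ g ∈ G, g ∈ IsLocalRing.maximalIdeal C.localRing) (hG0 : ∀ g ∈ G, g ≠ 0) :
    List.TFAE [
      -- every nonzero element has a `k`-reduction for all `k ∈ I_g`
      ∀ g : C.localRing, g ≠ 0 → ∀ k ∈ C.finiteIndices g, ∃ h, C.IsReductionAt G k g h,
      -- every nonzero element has a reduction
      ∀ g : C.localRing, g ≠ 0 → ∃ h, C.IsReduction G g h,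
      -- `G` is a Standard Basis
      C.IsStandardBasis G,
      -- for every nonzero element and some `k ∈ I_g` there is a suitable `G`-product
      ∀ g : C.localRing, g ≠ 0 → ∃ k ∈ C.finiteIndices g, ∃ α : C.localRing → ℕ,
        (∀ i, C.val g i ≤ C.val (C.prodPow G α) i) ∧ C.val g k = C.val (C.prodPow G α) k,
      -- for every nonzero element and all `k ∈ I_g` there is a suitable `G`-product
      ∀ g : C.localRing, g ≠ 0 → ∀ k ∈ C.finiteIndices g, ∃ α : C.localRing → ℕ,
        (∀ i, C.val g i ≤ C.val (C.prodPow G α) i) ∧ C.val g k = C.val (C.prodPow G α) k] := by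
  tfae_have 1 → 2 := fun h g hg =>
    have ⟨k, hk⟩ := C.finiteIndices_nonempty hg
    have ⟨h', hh'⟩ := h g hg k hk
    ⟨h', k, hk, hh'⟩
  tfae_have 2 ↔ 3 := ⟨fun h => ⟨hG, hGM, hG0, h⟩, fun h => h.exists_reduction⟩
  tfae_have 2 → 4 := fun h g hg =>
    have ⟨_, k, hk, hred⟩ := h g hg
    ⟨k, hk, hred.exists_val⟩
  tfae_have 4 → 5 := fun h g _ k hk => by
    obtain ⟨_, ⟨α, rfl⟩, hα⟩ := C.exists_mem_val_le_and_val_eq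
      (P := Set.range (C.prodPow G)) (fun g hg => by simpa using h g hg) g hk
    exact ⟨α, hα⟩
  tfae_have 5 → 1 := fun h g hg k hk =>
    have ⟨_, hle, heq⟩ := h g hg k hk
    C.exists_isReductionAt_of_val hk hle heq
  tfae_finish
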